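/- Let $\varphi:\mathbb R^n\to\mathbb R\cup\{+\infty\}$ and let $\bar x$ be a boundary point of the level set $[\varphi\le 0]:=\{x\mid\varphi(x)\le 0\}$. Assume that $\varphi$ is finite and convex on some convex neighborhood of $\bar x$, and that there is a neighborhood $V$ of $\bar x$ such that $$[\varphi\le 0]\cap V=\bigl(\bar x+[d\varphi(\bar x)\le 0]\bigr)\cap V ,$$ where $d\varphi(\bar x)(w):=\liminf_{t\downarrow 0,\,w'\to w}\frac{\varphi(\bar x+tw')-\varphi(\bar x)}{t}$ is the subderivative of $\varphi$ at $\bar x$ and $[d\varphi(\bar x)\le 0]:=\{w\in\mathbb R^n\mid d\varphi(\bar x)(w)\le 0\}$. Then $$d\bigl(0,\partial^>\varphi(\bar x)\bigr)=\operatorname{ebm}(\varphi,\bar x)=d\bigl(0,\partial^>\sigma_{\partial\varphi(\bar x)}(0)\bigr).$$ Here $\|\cdot\|$ is the Euclidean norm, $d(x,A):=\inf_{y\in A}\|y-x\|$ (with $d(x,\emptyset)=+\infty$), and: * $\operatorname{ebm}(\varphi,\bar x)\in[0,+\infty]$ is the local error bound modulus: the supremum of all $\tau>0$ such that $\tau\,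 d(x,[\varphi\le 0])\le\max\{\varphi(x),0\}$ for all $x$ in some neighborhood of $\bar x$ (which may depend on $\tau$), and $0$ if there is no such $\tau$. * For a function $g$ and a point $x$ with $g(x)$ finite, $v\in\hat\partial g(x)$ means $g(y)\ge g(x)+\langle v,y-x\rangle+o(\|y-x\|)$ as $y\to x$; $v\in\partial g(x)$ means that there are $x_k\to x$ with $g(x_k)\to g(x)$ and $v_k\in\hat\partial g(x_k)$ with $v_k\to v$; and $v\in\partial^>g(x)$ (the outer limiting subdifferential) means that there are $x_k\to x$ with $g(x_k)\to g(x)$, $g(x_k)>g(x)$, and $v_k\in\partial g(x_k)$ with $v_k\to v$. * $\sigma_A(w):=\sup_{v\in A}\langle v,w\rangle$ is the support function of $A\subset\mathbb R^n$. -/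

import Mathlib

open Filter Topology
open scoped ENNReal NNReal

noncomputable section

/-- `ℝⁿ` with the Euclidean norm and inner product. -/
abbrev RSpace (n : ℕ) : Type := EuclideanSpace ℝ (Fin n)

/-- The level set `[g ≤ 0]`. -/
def levelSet {n : ℕ} (g : RSpace n → EReal) : Set (RSpace n) :=
  {x | g x ≤ 0}

/-- `g` is finite and convex on the set `U`, which is itself required to be convex
(this is part of `ConvexOn`). -/
def FiniteConvexOn {n : ℕ} (U : Set (RSpace n)) (g : RSpace n → EReal) : Prop :=
  (∀ x ∈ U, g x ≠ ⊥ ∧ g x ≠ ⊤) ∧ ConvexOn ℝ U (fun x => (g x).toReal)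

/-- The support function `w ↦ sup {⟨x, w⟩ : x ∈ A}` of a set `A`. -/
def supportFunction {n : ℕ} (A : Set (RSpace n)) (w : RSpace n) : EReal :=
  ⨆ x ∈ A, ((inner ℝ x w : ℝ) : EReal)

/-- The regular subdifferential: those `v` for which
`g y ≥ g x + ⟨v, y - x⟩ + o(‖y - x‖)` as `y → x`; empty where `g` is not finite. -/
def regularSubdifferential {n : ℕ} (g : RSpace n → EReal) (x : RSpace n) :
    Set (RSpace n) :=
  {v | g x ≠ ⊥ ∧ g x ≠ ⊤ ∧ ∀ ε : ℝ, 0 < ε → ∀ᶠ y in 𝓝 x,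
    g x + ((inner ℝ v (y - x) - ε * ‖y - x‖ : ℝ) : EReal) ≤ g y}

/-- The (general, limiting) subdifferential: limits of regular subgradients `vₖ` at points
`xₖ → x` with `g xₖ → g x`; empty where `g` is not finite. -/
def subdifferential {n : ℕ} (g : RSpace n → EReal) (x : RSpace n) : Set (RSpace n) :=
  {v | g x ≠ ⊥ ∧ g x ≠ ⊤ ∧ ∃ (xs vs : ℕ → RSpace n),
    Tendsto xs atTop (𝓝 x) ∧ Tendsto (fun k => g (xs k)) atTop (𝓝 (g x)) ∧
    Tendsto vs atTop (𝓝 v) ∧ ∀ k, vs k ∈ regularSubdifferential g (xs k)}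

/-- The outer limiting subdifferential: limits of subgradients `vₖ` at points `xₖ → x`
with `g xₖ → g x` and `g xₖ > g x`. -/
def outerSubdifferential {n : ℕ} (g : RSpace n → EReal) (x : RSpace n) :
    Set (RSpace n) :=
  {v | g x ≠ ⊥ ∧ g x ≠ ⊤ ∧ ∃ (xs vs : ℕ → RSpace n),
    Tendsto xs atTop (𝓝 x) ∧ Tendsto (fun k => g (xs k)) atTop (𝓝 (g x)) ∧
    Tendsto vs atTop (𝓝 v) ∧ ∀ k, g x < g (xs k) ∧ vs k ∈ subdifferential g (xs k)}

/-- The subderivative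
`dg(x)(w) = liminf_{t ↓ 0, w' → w} (g (x + t w') - g x) / t`. -/
def subderivative {n : ℕ} (g : RSpace n → EReal) (x w : RSpace n) : EReal :=
  liminf (fun p : ℝ × RSpace n => (g (x + p.1 • p.2) - g x) / (p.1 : EReal))
    (𝓝[>] (0 : ℝ) ×ˢ 𝓝 w)

/-- `τ` is an error bound constant of `g` at `x` on some neighbourhood of `x`:
`τ d(y, [g ≤ 0]) ≤ max (g y) 0` for all `y` near `x`. -/
def IsErrorBoundConstant {n : ℕ} (g : RSpace n → EReal) (x : RSpace n) (τ : ℝ≥0) :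
    Prop :=
  0 < τ ∧ ∃ U ∈ 𝓝 x, ∀ y ∈ U,
    (((τ : ℝ≥0∞) * Metric.infEDist y (levelSet g) : ℝ≥0∞) : EReal) ≤ max (g y) 0

/-- The local error bound modulus: the supremum in `[0, ∞]` of all error bound constants,
equal to `0` when there are none. -/
def errorBoundModulus {n : ℕ} (g : RSpace n → EReal) (x : RSpace n) : ℝ≥0∞ :=
  ⨆ (τ : ℝ≥0) (_ : IsErrorBoundConstant g x τ), (τ : ℝ≥0∞)

end

/-! Both equalities come from one fact: if `g` is finite and convex near a zero `x`, the distance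
from the origin to the outer subdifferential equals the error bound modulus
(`FiniteConvexOn.infEDist_outerSubdifferential_eq`). If the bound with constant `τ` fails
arbitrarily close to `x`, minimizing `max f 0` plus `τ` times a smoothed distance yields nearby
points with `f > 0` and regular subgradients of norm at most `τ`, and compactness gives an outer
subgradient. Conversely, the subgradient inequality bounds `f` by the subgradient norm times the
distance to the level set.

Convexity makes the directional derivative `p` at `xbar` both the subderivative and the support
function of the subdifferential, so the fact applies to `p` at the origin as well. It remains to see
that `φ` and `p` have the same error bound constants. By hypothesis the level set is locally the
translated cone `[p ≤ 0]`, so the distances agree near `xbar`; blowing up along rays passes from `φ`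
to `p`, and `p (y - xbar) ≤ f y` gives the way back. -/

/-! ### Subgradients of functions convex near a point -/

open Metric Set in
/-- On a ball around a point of a neighbourhood where it is finite and convex, an extended-real
function is given by a continuous convex real function. -/
theorem FiniteConvexOn.exists_ball {n : ℕ} {g : RSpace n → EReal} {x : RSpace n}
    {U : Set (RSpace n)} (hU : U ∈ 𝓝 x) (hg : FiniteConvexOn U g) :
    ∃ (f : RSpace n → ℝ) (r : ℝ), 0 < r ∧ ConvexOn ℝ (ball x r) f ∧
      ContinuousOn f (ball x r) ∧ ∀ y ∈ ball x r, g y = f y := by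
  obtain ⟨r, hr, hrU⟩ := Metric.mem_nhds_iff.1 hU
  have hc : ConvexOn ℝ (ball x r) (fun y => (g y).toReal) := hg.2.subset hrU (convex_ball x r)
  refine ⟨_, r, hr, hc, hc.continuousOn isOpen_ball, fun y hy => ?_⟩
  exact (EReal.coe_toReal (hg.1 y (hrU hy)).2 (hg.1 y (hrU hy)).1).symm

/-- Characterization of a regular subgradient where the function is locally real-valued. -/
theorem mem_regularSubdifferential_of_eventually {n : ℕ} {g : RSpace n → EReal}
    {f : RSpace n → ℝ} {x v : RSpace n} (hgf : ∀ᶠ y in 𝓝 x, g y = f y)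
    (h : ∀ ε : ℝ, 0 < ε → ∀ᶠ y in 𝓝 x, f x + (inner ℝ v (y - x) - ε * ‖y - x‖) ≤ f y) :
    v ∈ regularSubdifferential g x := by
  have hx : g x = f x := hgf.self_of_nhds
  refine ⟨by simp [hx], by simp [hx], fun ε hε => ?_⟩
  filter_upwards [hgf, h ε hε] with y hy hy'
  rw [hx, hy]
  exact_mod_cast hy'

theorem regularSubdifferential_subset_subdifferential {n : ℕ} (g : RSpace n → EReal)
    (x : RSpace n) : regularSubdifferential g x ⊆ subdifferential g x := fun v hv =>
  ⟨hv.1, hv.2.1, fun _ => x, fun _ => v, tendsto_const_nhds, tendsto_const_nhds,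
    tendsto_const_nhds, fun _ => hv⟩

open Metric Set in
/-- Regular subgradients of a convex function satisfy the subgradient inequality. -/
theorem ConvexOn.subgradient_inequality_of_mem_regularSubdifferential {n : ℕ}
    {g : RSpace n → EReal} {f : RSpace n → ℝ} {s : Set (RSpace n)} {y z v : RSpace n}
    (hf : ConvexOn ℝ s f) (hgf : ∀ y ∈ s, g y = f y)
    (hy : y ∈ s) (hz : z ∈ s) (hv : v ∈ regularSubdifferential g y) :
    f y + inner ℝ v (z - y) ≤ f z := by
  -- Test the regular inequality at a point of the segment from `y` to `z`, bound `f` there by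
  -- convexity, and cancel `t`.
  have key : ∀ ε : ℝ, 0 < ε → f y + inner ℝ v (z - y) ≤ f z + ε * ‖z - y‖ := by
    intro ε hε
    have hlim : Tendsto (fun t : ℝ => y + t • (z - y)) (𝓝[>] 0) (𝓝 y) := by
      have : Tendsto (fun t : ℝ => y + t • (z - y)) (𝓝 0) (𝓝 (y + (0 : ℝ) • (z - y))) :=
        Continuous.tendsto (by fun_prop) _
      simpa using this.mono_left nhdsWithin_le_nhds
    have h1 := hlim.eventually (hv.2.2 ε hε)
    have h2 : ∀ᶠ t : ℝ in 𝓝[>] 0, t ∈ Ioo (0 : ℝ) 1 := Ioo_mem_nhdsGT one_pos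
    obtain ⟨t, ht1, ht0, htlt⟩ := (h1.and h2).exists
    have hcomb : y + t • (z - y) = (1 - t) • y + t • z := by module
    have hmem : y + t • (z - y) ∈ s := by
      rw [hcomb]; exact hf.1 hy hz (by linarith) ht0.le (by ring)
    have hcv := hf.2 hy hz (show 0 ≤ 1 - t by linarith) ht0.le (by ring)
    rw [← hcomb] at hcv
    rw [hgf y hy, hgf _ hmem] at ht1
    have ht2 : f y + (inner ℝ v (y + t • (z - y) - y) - ε * ‖y + t • (z - y) - y‖)
        ≤ f (y + t • (z - y)) := by exact_mod_cast ht1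
    rw [add_sub_cancel_left, inner_smul_right, norm_smul, Real.norm_of_nonneg ht0.le] at ht2
    simp only [smul_eq_mul] at hcv
    have : t * (f y + inner ℝ v (z - y)) ≤ t * (f z + ε * ‖z - y‖) := by nlinarith
    exact le_of_mul_le_mul_left this ht0
  refine le_of_forall_pos_le_add fun δ hδ => ?_
  have hN : 0 < ‖z - y‖ + 1 := by positivity
  refine (key (δ / (‖z - y‖ + 1)) (by positivity)).trans ?_
  have : δ / (‖z - y‖ + 1) * ‖z - y‖ ≤ δ := by
    rw [div_mul_eq_mul_div, div_le_iff₀ hN]; nlinarith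
  linarith

/-- Limiting subgradients of a convex function satisfy the subgradient inequality. -/
theorem ConvexOn.subgradient_inequality_of_mem_subdifferential {n : ℕ}
    {g : RSpace n → EReal} {f : RSpace n → ℝ} {s : Set (RSpace n)} {y z v : RSpace n}
    (hf : ConvexOn ℝ s f) (hs : IsOpen s) (hgf : ∀ y ∈ s, g y = f y)
    (hy : y ∈ s) (hz : z ∈ s) (hv : v ∈ subdifferential g y) :
    f y + inner ℝ v (z - y) ≤ f z := by
  obtain ⟨-, -, xs, vs, hxs, -, hvs, hreg⟩ := hv
  have hfc : Tendsto (fun k => f (xs k)) atTop (𝓝 (f y)) :=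
    ((hf.continuousOn hs).continuousAt (hs.mem_nhds hy)).tendsto.comp hxs
  have hlim : Tendsto (fun k => f (xs k) + inner ℝ (vs k) (z - xs k)) atTop
      (𝓝 (f y + inner ℝ v (z - y))) :=
    hfc.add (hvs.inner (tendsto_const_nhds.sub hxs))
  refine le_of_tendsto hlim ?_
  filter_upwards [hxs.eventually (hs.mem_nhds hy)] with k hk
  exact hf.subgradient_inequality_of_mem_regularSubdifferential hgf hk hz (hreg k)

theorem ConvexOn.mem_subdifferential_iff {n : ℕ}
    {g : RSpace n → EReal} {f : RSpace n → ℝ} {s : Set (RSpace n)} {y v : RSpace n}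
    (hf : ConvexOn ℝ s f) (hs : IsOpen s) (hgf : ∀ y ∈ s, g y = f y) (hy : y ∈ s) :
    v ∈ subdifferential g y ↔ ∀ z ∈ s, f y + inner ℝ v (z - y) ≤ f z := by
  refine ⟨fun hv z hz => hf.subgradient_inequality_of_mem_subdifferential hs hgf hy hz hv,
    fun h => regularSubdifferential_subset_subdifferential _ _ ?_⟩
  refine mem_regularSubdifferential_of_eventually
    (by filter_upwards [hs.mem_nhds hy] with z hz using hgf z hz) fun ε hε => ?_
  filter_upwards [hs.mem_nhds hy] with z hz
  have := h z hz
  have : 0 ≤ ε * ‖z - y‖ := by positivity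
  linarith

/-! ### Error bounds and outer subgradients -/

theorem isErrorBoundConstant_iff {n : ℕ} {g : RSpace n → EReal} {f : RSpace n → ℝ}
    {x : RSpace n} {τ : ℝ≥0} (hne : (levelSet g).Nonempty) (hgf : ∀ᶠ y in 𝓝 x, g y = f y) :
    IsErrorBoundConstant g x τ ↔
      0 < τ ∧ ∀ᶠ y in 𝓝 x, (τ : ℝ) * Metric.infDist y (levelSet g) ≤ max (f y) 0 := by
  have hcoe : ∀ y, g y = f y →
      (((((τ : ℝ≥0∞) * Metric.infEDist y (levelSet g) : ℝ≥0∞) : EReal) ≤ max (g y) 0) ↔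
      (τ : ℝ) * Metric.infDist y (levelSet g) ≤ max (f y) 0) := by
    intro y hy
    have h1 : Metric.infEDist y (levelSet g) = ENNReal.ofReal (Metric.infDist y (levelSet g)) :=
      (ENNReal.ofReal_toReal (Metric.infEDist_ne_top hne)).symm
    have h2 : (τ : ℝ≥0∞) = ENNReal.ofReal (τ : ℝ) := (ENNReal.ofReal_coe_nnreal).symm
    rw [h1, h2, ← ENNReal.ofReal_mul (NNReal.coe_nonneg τ), EReal.coe_ennreal_ofReal,
      max_eq_left (mul_nonneg (NNReal.coe_nonneg τ) Metric.infDist_nonneg), hy]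
    rw [le_max_iff, le_max_iff]
    norm_cast
  unfold IsErrorBoundConstant
  refine and_congr_right fun _ => ?_
  rw [← Filter.eventually_iff_exists_mem]
  refine Filter.eventually_congr ?_
  filter_upwards [hgf] with y hy using hcoe y hy

open Metric Set in
/-- Failure of the error bound with constant `τ` at a point `x` produces a nearby point outside the
level set with a regular subgradient of norm at most `τ`. -/
theorem exists_regularSubgradient_of_lt_infDist {n : ℕ} {g : RSpace n → EReal}
    {f : RSpace n → ℝ} {x₀ x : RSpace n} {r τ : ℝ} (hf : ContinuousOn f (ball x₀ r))
    (hgf : ∀ y ∈ ball x₀ r, g y = f y) (hx₀ : x₀ ∈ levelSet g) (hx : dist x x₀ < r / 4)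
    (hτ : 0 < τ) (hlt : max (f x) 0 < τ * infDist x (levelSet g)) :
    ∃ y v, dist y x ≤ dist x x₀ ∧ 0 < f y ∧ ‖v‖ ≤ τ ∧ v ∈ regularSubdifferential g y := by
  set d := infDist x (levelSet g) with hd
  have hdx : d ≤ dist x x₀ := infDist_le_dist_of_mem hx₀
  have hr : 0 < r := by linarith [dist_nonneg (x := x) (y := x₀)]
  -- Half the slack: replacing the norm by `√(‖·‖² + ε²)` makes the penalty differentiable even at
  -- `x`, yet the value at `x` stays below `τ * d`.
  set ε : ℝ := (d - max (f x) 0 / τ) / 2 with hε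
  have hd0 : max (f x) 0 / τ < d := by rw [div_lt_iff₀ hτ]; linarith
  have hε0 : 0 < ε := by rw [hε]; linarith
  have hεd : max (f x) 0 + τ * ε < τ * d := by
    have h1 : max (f x) 0 / τ + ε < d := by rw [hε]; linarith
    have h2 := mul_lt_mul_of_pos_left h1 hτ
    rwa [mul_add, mul_div_cancel₀ _ hτ.ne'] at h2
  let q : RSpace n → ℝ := fun y => Real.sqrt (‖y - x‖ ^ 2 + ε ^ 2)
  have hqpos : ∀ y, 0 < ‖y - x‖ ^ 2 + ε ^ 2 := fun y => by positivity
  have hqc : Continuous q := by fun_prop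
  have hsub : closedBall x₀ (r / 2) ⊆ ball x₀ r := closedBall_subset_ball (by linarith)
  have hcont : ContinuousOn (fun y => max (f y) 0 + τ * q y) (closedBall x₀ (r / 2)) :=
    (ContinuousOn.sup (hf.mono hsub) continuousOn_const).add (continuousOn_const.mul hqc.continuousOn)
  have hxB : x ∈ closedBall x₀ (r / 2) := by rw [mem_closedBall]; linarith
  obtain ⟨y, hyB, hmin⟩ := (isCompact_closedBall x₀ (r / 2)).exists_isMinOn ⟨x, hxB⟩ hcont
  have hval : max (f y) 0 + τ * q y < τ * d := by
    have h1 : max (f y) 0 + τ * q y ≤ max (f x) 0 + τ * q x := hmin hxB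
    have h2 : q x = ε := by simp [q, Real.sqrt_sq hε0.le]
    rw [h2] at h1
    linarith
  have hyq : ‖y - x‖ ≤ q y := Real.le_sqrt_of_sq_le (by nlinarith)
  -- The minimizer is closer to `x` than the level set is, so it lies outside that set.
  have hyd : dist y x < d := by
    have : 0 ≤ max (f y) 0 := le_max_right _ _
    have h3 : τ * q y < τ * d := by linarith
    rw [dist_eq_norm]
    exact hyq.trans_lt (lt_of_mul_lt_mul_left h3 hτ.le)
  have hyS : y ∉ levelSet g := fun h => by
    have := infDist_le_dist_of_mem (x := x) h
    rw [dist_comm] at this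
    linarith
  have hyball : y ∈ ball x₀ (r / 2) := by
    rw [mem_ball]
    linarith [dist_triangle y x x₀]
  have hyr : y ∈ ball x₀ r := hsub hyB
  have hfy : 0 < f y := by
    have : ¬ g y ≤ 0 := hyS
    rw [hgf y hyr] at this
    simpa using this
  have hfcont : ContinuousAt f y := hf.continuousAt (isOpen_ball.mem_nhds hyr)
  -- This is `-τ ∇q(y)`, as Fermat's rule dictates; its norm is at most `τ` because `‖y - x‖ ≤ q y`.
  let v : RSpace n := (-(τ / q y)) • (y - x)
  have hqy : 0 < q y := Real.sqrt_pos.2 (hqpos y)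
  have hderiv : HasFDerivAt q ((q y)⁻¹ • innerSL ℝ (y - x)) y := by
    have h1 : HasFDerivAt (fun z : RSpace n => ‖z - x‖ ^ 2 + ε ^ 2)
        ((2 : ℝ) • innerSL ℝ (y - x)) y := by
      have h := ((hasFDerivAt_id (𝕜 := ℝ) y).sub_const x).norm_sq.add_const (ε ^ 2)
      refine h.congr_fderiv ?_
      ext w
      simp
    refine (h1.sqrt (hqpos y).ne').congr_fderiv ?_
    rw [smul_smul]
    congr 1
    simp only [q]
    field_simp
  refine ⟨y, v, hyd.le.trans hdx, hfy, ?_, ?_⟩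
  · simp only [v, norm_smul, norm_neg, norm_div, Real.norm_of_nonneg hτ.le,
      Real.norm_of_nonneg hqy.le]
    rw [div_mul_eq_mul_div, div_le_iff₀ hqy]
    exact mul_le_mul_of_nonneg_left hyq hτ.le
  · refine mem_regularSubdifferential_of_eventually (f := f) ?_ fun δ hδ => ?_
    · filter_upwards [isOpen_ball.mem_nhds hyr] with z hz using hgf z hz
    · have hlo := (hasFDerivAt_iff_isLittleO.1 hderiv).def (c := δ / τ) (by positivity)
      -- Near `y` the function is positive, so the truncation disappears from the minimality
      -- inequality.
      filter_upwards [hlo, isOpen_ball.mem_nhds hyball, hfcont.eventually (lt_mem_nhds hfy)]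
        with z hz hzB hzf
      have h1 : max (f y) 0 + τ * q y ≤ max (f z) 0 + τ * q z := hmin (ball_subset_closedBall hzB)
      rw [max_eq_left hfy.le, max_eq_left hzf.le] at h1
      have h2 := (le_abs_self _).trans hz
      simp only [_root_.smul_apply, innerSL_apply_apply, smul_eq_mul] at h2
      have h3 := mul_le_mul_of_nonneg_left h2 hτ.le
      have h4 : τ * (δ / τ * ‖z - y‖) = δ * ‖z - y‖ := by field_simp
      have h5 : inner ℝ v (z - y) = -(τ * ((q y)⁻¹ * inner ℝ (y - x) (z - y))) := by
        simp only [v, inner_smul_left, RCLike.conj_to_real]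
        ring
      rw [h4] at h3
      rw [h5]
      nlinarith

open Metric Set in
/-- For a function that is finite and convex near a zero, the distance of the origin to the outer
subdifferential is the error bound modulus. -/
theorem FiniteConvexOn.infEDist_outerSubdifferential_eq {n : ℕ} {g : RSpace n → EReal}
    {x : RSpace n} {U : Set (RSpace n)} (hU : U ∈ 𝓝 x) (hg : FiniteConvexOn U g)
    (hx : g x = 0) :
    infEDist 0 (outerSubdifferential g x) = errorBoundModulus g x := by
  obtain ⟨f, r, hr, hfc, hf, hgf⟩ := hg.exists_ball hU
  have hxS : x ∈ levelSet g := hx.le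
  have hxr : x ∈ ball x r := mem_ball_self hr
  have hball : ball x r ∈ 𝓝 x := ball_mem_nhds x hr
  have hev : ∀ᶠ y in 𝓝 x, g y = f y := by filter_upwards [hball] with y hy using hgf y hy
  have hfx : f x = 0 := by
    have := hgf x hxr
    rw [hx] at this
    exact_mod_cast this.symm
  have hfx' : ContinuousAt f x := hf.continuousAt hball
  refine le_antisymm (ENNReal.le_of_forall_nnreal_lt fun τ hτ => ?_) ?_
  · rcases eq_or_ne τ 0 with rfl | hτ0
    · simp
    have hτpos : 0 < τ := pos_iff_ne_zero.2 hτ0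
    refine le_iSup₂_of_le (f := fun (τ : ℝ≥0) (_ : IsErrorBoundConstant g x τ) => (τ : ℝ≥0∞)) τ
      ((isErrorBoundConstant_iff ⟨x, hxS⟩ hev).2 ⟨hτpos, ?_⟩) le_rfl
    by_contra hcon
    have hfreq : ∃ᶠ y in 𝓝 x, max (f y) 0 < τ * infDist y (levelSet g) := by
      simpa only [not_eventually, not_le] using hcon
    obtain ⟨xs, hxs, hbad⟩ := Filter.exists_seq_forall_of_frequently
      (hfreq.and_eventually (ball_mem_nhds x (ε := r / 4) (by linarith)))
    choose ys vs hys hpos hvs hreg using fun k => exists_regularSubgradient_of_lt_infDist hf hgf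
      hxS (hbad k).2 (by exact_mod_cast hτpos) (hbad k).1
    have hysx : Tendsto ys atTop (𝓝 x) := by
      have h1 : Tendsto (fun k => dist (xs k) x) atTop (𝓝 0) :=
        tendsto_iff_dist_tendsto_zero.1 hxs
      refine tendsto_iff_dist_tendsto_zero.2 (squeeze_zero (fun _ => dist_nonneg)
        (fun k => ?_) (by simpa using h1.add h1))
      exact (dist_triangle (ys k) (xs k) x).trans (add_le_add_left (hys k) _)
    obtain ⟨v, hv, ψ, hψ, hlim⟩ := (isCompact_closedBall (0 : RSpace n) (τ : ℝ)).tendsto_subseq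
      (x := vs) (fun k => by simpa using hvs k)
    have hysr : ∀ k, ys k ∈ ball x r := fun k => by
      have h1 : dist (xs k) x < r / 4 := (hbad k).2
      have := dist_triangle (ys k) (xs k) x
      have := hys k
      rw [mem_ball]; linarith
    have hys' := hysx.comp hψ.tendsto_atTop
    have hmem : v ∈ outerSubdifferential g x := by
      refine ⟨by simp [hx], by simp [hx], ys ∘ ψ, vs ∘ ψ, hys', ?_, hlim, fun k => ⟨?_, ?_⟩⟩
      · have : (fun k => g ((ys ∘ ψ) k)) = fun k => ((f ((ys ∘ ψ) k) : ℝ) : EReal) :=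
          funext fun k => hgf _ (hysr _)
        rw [this, hgf x hxr]
        exact (continuous_coe_real_ereal.tendsto _).comp (hfx'.tendsto.comp hys')
      · rw [hx, Function.comp_apply, hgf _ (hysr (ψ k))]
        exact_mod_cast hpos (ψ k)
      · exact regularSubdifferential_subset_subdifferential _ _ (hreg (ψ k))
    have h1 := infEDist_le_edist_of_mem (x := (0 : RSpace n)) hmem
    have h2 : edist 0 v ≤ τ := by
      rw [edist_comm, edist_zero_right]
      rw [mem_closedBall_zero_iff] at hv
      exact_mod_cast hv
    exact absurd (hτ.trans_le (h1.trans h2)) (lt_irrefl _)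
  · refine iSup₂_le fun τ hτ => le_infEDist.2 fun v hv => ?_
    obtain ⟨-, hτ⟩ := (isErrorBoundConstant_iff ⟨x, hxS⟩ hev).1 hτ
    obtain ⟨-, -, xs, vs, hxs, -, hvs, hk⟩ := hv
    have hfin : (τ : ℝ) ≤ ‖v‖ := by
      refine ge_of_tendsto hvs.norm ?_
      filter_upwards [hxs.eventually hτ, hxs.eventually (ball_mem_nhds x (ε := r / 4)
        (by linarith))] with k h1 h2
      have h2 : dist (xs k) x < r / 4 := h2
      have hmem : xs k ∈ ball x r := by rw [mem_ball]; linarith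
      have hpos : 0 < f (xs k) := by
        have := (hk k).1
        rw [hx, hgf _ hmem] at this
        exact_mod_cast this
      rw [max_eq_left hpos.le] at h1
      have hle : ∀ z ∈ levelSet g, dist (xs k) z < r / 2 → f (xs k) ≤ ‖vs k‖ * dist (xs k) z := by
        intro z hz hzd
        have hzr : z ∈ ball x r := by
          rw [mem_ball]
          have := dist_triangle_left z x (xs k)
          linarith
        have h3 := hfc.subgradient_inequality_of_mem_subdifferential isOpen_ball hgf hmem hzr
          (hk k).2
        have h4 : f z ≤ 0 := by
          have : g z ≤ 0 := hz
          rw [hgf z hzr] at this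
          exact_mod_cast this
        have h5 := neg_le_of_abs_le (abs_real_inner_le_norm (vs k) (z - xs k))
        rw [dist_comm, dist_eq_norm]
        linarith
      set d := infDist (xs k) (levelSet g)
      have hdle : d ≤ dist (xs k) x := infDist_le_dist_of_mem hxS
      -- The infimum need not be attained, so points within `d + δ` are used; `d` and `δ` are both
      -- below `r / 4`, which keeps them within the reach of `hle`.
      have hfd : f (xs k) ≤ ‖vs k‖ * d := by
        have hlim : Tendsto (fun δ : ℝ => ‖vs k‖ * (d + δ)) (𝓝[>] 0) (𝓝 (‖vs k‖ * (d + 0))) :=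
          (Continuous.tendsto (by fun_prop) _).mono_left nhdsWithin_le_nhds
        rw [add_zero] at hlim
        refine ge_of_tendsto hlim ?_
        filter_upwards [Ioo_mem_nhdsGT (show (0 : ℝ) < r / 4 by linarith)] with δ hδ
        obtain ⟨z, hz, hzd⟩ := (infDist_lt_iff ⟨x, hxS⟩).1 (show d < d + δ by linarith [hδ.1])
        exact (hle z hz (by linarith [hδ.2])).trans
          (mul_le_mul_of_nonneg_left hzd.le (norm_nonneg _))
      have hd0 : 0 < d := by
        rcases (infDist_nonneg (x := xs k) (s := levelSet g)).eq_or_lt with h | h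
        · have : d = 0 := h.symm
          rw [this, mul_zero] at hfd
          linarith
        · exact h
      exact le_of_mul_le_mul_right (h1.trans hfd) hd0
    rw [edist_comm, edist_zero_right]
    exact_mod_cast hfin

/-! ### Directional derivatives of convex functions -/

section DirectionalDerivative

variable {E : Type*} [NormedAddCommGroup E] [NormedSpace ℝ E] {f : E → ℝ} {x : E} {s : Set E}

theorem tendsto_add_smul_nhdsGT_zero (x w : E) :
    Tendsto (fun t : ℝ => x + t • w) (𝓝[>] 0) (𝓝 x) := by
  have : Tendsto (fun t : ℝ => x + t • w) (𝓝 0) (𝓝 (x + (0 : ℝ) • w)) :=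
    Continuous.tendsto (by fun_prop) _
  simpa using this.mono_left nhdsWithin_le_nhds

/-- A convex function has one-sided directional derivatives at points of an open set. -/
theorem ConvexOn.exists_tendsto_directional_quotient (hf : ConvexOn ℝ s f) (hs : IsOpen s)
    (hx : x ∈ s) (w : E) :
    ∃ p : ℝ, Tendsto (fun t : ℝ => (f (x + t • w) - f x) / t) (𝓝[>] 0) (𝓝 p) := by
  let A : ℝ →ᵃ[ℝ] E := AffineMap.lineMap x (x + w)
  have hA : ∀ t : ℝ, A t = x + t • w := fun t => by
    simp [A, AffineMap.lineMap_apply, add_comm]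
  have hAc : Continuous A := by
    have : (A : ℝ → E) = fun t => x + t • w := funext hA
    rw [this]
    fun_prop
  have h0 : (0 : ℝ) ∈ interior (A ⁻¹' s) := by
    rw [(hs.preimage hAc).interior_eq, Set.mem_preimage, hA]
    simpa using hx
  have hd := (hf.comp_affineMap A).hasDerivWithinAt_sInf_slope_of_mem_interior h0
  rw [hasDerivWithinAt_iff_tendsto_slope' Set.self_notMem_Ioi] at hd
  refine ⟨_, hd.congr fun t => ?_⟩
  simp [slope_def_field, hA]

variable {p : E → ℝ}

theorem directional_derivative_smul
    (hp : ∀ w, Tendsto (fun t : ℝ => (f (x + t • w) - f x) / t) (𝓝[>] 0) (𝓝 (p w)))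
    {c : ℝ} (hc : 0 < c) (w : E) : p (c • w) = c * p w := by
  have hm : Tendsto (fun t : ℝ => t * c) (𝓝[>] 0) (𝓝[>] 0) := by
    refine tendsto_nhdsWithin_iff.2 ⟨?_, ?_⟩
    · have : Tendsto (fun t : ℝ => t * c) (𝓝 0) (𝓝 (0 * c)) := Continuous.tendsto (by fun_prop) _
      simpa using this.mono_left nhdsWithin_le_nhds
    · filter_upwards [self_mem_nhdsWithin] with t ht using mul_pos ht hc
  refine tendsto_nhds_unique (hp (c • w)) ((((hp w).comp hm).const_mul c).congr fun t => ?_)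
  simp only [Function.comp_apply, smul_smul]
  rcases eq_or_ne t 0 with rfl | ht
  · simp
  · field_simp

/-- The point `x + t(v + w)` is the midpoint of `x + 2tv` and `x + 2tw`; homogeneity absorbs the
factor two. -/
theorem ConvexOn.directional_derivative_add_le (hf : ConvexOn ℝ s f) (hs : IsOpen s)
    (hx : x ∈ s)
    (hp : ∀ w, Tendsto (fun t : ℝ => (f (x + t • w) - f x) / t) (𝓝[>] 0) (𝓝 (p w)))
    (v w : E) : p (v + w) ≤ p v + p w := by
  have h2 : ∀ w, p w = p ((2 : ℝ) • w) / 2 := fun w => by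
    rw [directional_derivative_smul hp two_pos]; ring
  rw [h2 v, h2 w, ← add_div]
  refine le_of_tendsto_of_tendsto (hp (v + w))
    (((hp ((2 : ℝ) • v)).add (hp ((2 : ℝ) • w))).div_const 2) ?_
  filter_upwards [self_mem_nhdsWithin,
    (tendsto_add_smul_nhdsGT_zero x ((2 : ℝ) • v)).eventually (hs.mem_nhds hx),
    (tendsto_add_smul_nhdsGT_zero x ((2 : ℝ) • w)).eventually (hs.mem_nhds hx)] with t ht hv hw
  have ht : 0 < t := ht
  have h := hf.2 hv hw (show (0 : ℝ) ≤ 1 / 2 by norm_num) (show (0 : ℝ) ≤ 1 / 2 by norm_num)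
    (by norm_num)
  have he : (1 / 2 : ℝ) • (x + t • (2 : ℝ) • v) + (1 / 2 : ℝ) • (x + t • (2 : ℝ) • w)
      = x + t • (v + w) := by module
  rw [he] at h
  simp only [smul_eq_mul] at h
  rw [← add_div, div_div, div_le_div_iff₀ ht (by positivity)]
  nlinarith

theorem ConvexOn.add_directional_derivative_le (hf : ConvexOn ℝ s f)
    (hx : x ∈ s)
    (hp : ∀ w, Tendsto (fun t : ℝ => (f (x + t • w) - f x) / t) (𝓝[>] 0) (𝓝 (p w)))
    {z : E} (hz : z ∈ s) : f x + p (z - x) ≤ f z := by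
  have : p (z - x) ≤ f z - f x := by
    refine le_of_tendsto (hp (z - x)) ?_
    filter_upwards [Ioo_mem_nhdsGT one_pos] with t ht
    have h := hf.2 hx hz (show 0 ≤ 1 - t by linarith [ht.2]) ht.1.le (by ring)
    have he : (1 - t) • x + t • z = x + t • (z - x) := by module
    rw [he] at h
    simp only [smul_eq_mul] at h
    rw [div_le_iff₀ ht.1]
    linarith
  linarith

end DirectionalDerivative

/-! ### Support function and subderivative -/

/-- A sublinear function on a finite-dimensional Euclidean space is at each point attained by a
linear form that it dominates. -/
theorem exists_inner_le_sublinear_eq {n : ℕ} {p : RSpace n → ℝ}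
    (hom : ∀ c : ℝ, 0 < c → ∀ w, p (c • w) = c * p w) (hadd : ∀ v w, p (v + w) ≤ p v + p w)
    (w : RSpace n) : ∃ v : RSpace n, (∀ z, inner ℝ v z ≤ p z) ∧ inner ℝ v w = p w := by
  have p0 : p 0 = 0 := by
    have := hom 2 two_pos 0
    rw [smul_zero] at this
    linarith
  -- Makes `c • w ↦ c * p w` well defined on the span even when `w = 0`; Hahn–Banach then extends
  -- it.
  have H : ∀ c : ℝ, c • w = 0 → c • p w = 0 := by
    intro c hc
    rcases smul_eq_zero.1 hc with h | h
    · simp [h]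
    · simp [h, p0]
  let F : RSpace n →ₗ.[ℝ] ℝ := LinearPMap.mkSpanSingleton' w (p w) H
  have hF : ∀ (c : ℝ) (h : c • w ∈ F.domain), F ⟨c • w, h⟩ = c * p w := fun c h =>
    LinearPMap.mkSpanSingleton'_apply w (p w) H c h
  have hle : ∀ y : F.domain, F y ≤ p y := by
    rintro ⟨y, hy⟩
    obtain ⟨c, rfl⟩ := Submodule.mem_span_singleton.1 hy
    rw [hF c hy]
    rcases lt_trichotomy c 0 with hc | rfl | hc
    -- For negative multiples, domination follows from `0 = p 0 ≤ p (c • w) + p (-c • w)`.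
    · have h1 := hadd (c • w) ((-c) • w)
      rw [← add_smul, add_neg_cancel, zero_smul, p0, hom (-c) (by linarith)] at h1
      show c * p w ≤ p (c • w)
      linarith
    · simp [p0]
    · exact (hom c hc w).ge
  obtain ⟨G, hG, hGle⟩ := exists_extension_of_le_sublinear F p hom hadd hle
  refine ⟨(InnerProductSpace.toDual ℝ (RSpace n)).symm (LinearMap.toContinuousLinearMap G),
    fun z => ?_, ?_⟩
  · simpa [InnerProductSpace.toDual_symm_apply] using hGle z
  · have hw : (1 : ℝ) • w ∈ F.domain := Submodule.smul_mem _ _ (Submodule.mem_span_singleton_self w)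
    have := hG ⟨_, hw⟩
    rw [hF 1 hw] at this
    simpa [InnerProductSpace.toDual_symm_apply] using this

section Representation

variable {n : ℕ} {g : RSpace n → EReal} {f p : RSpace n → ℝ} {s : Set (RSpace n)} {x : RSpace n}

/-- The support function of the subdifferential of a convex function is its directional
derivative. -/
theorem ConvexOn.supportFunction_subdifferential (hf : ConvexOn ℝ s f) (hs : IsOpen s)
    (hgf : ∀ y ∈ s, g y = f y) (hx : x ∈ s)
    (hp : ∀ w, Tendsto (fun t : ℝ => (f (x + t • w) - f x) / t) (𝓝[>] 0) (𝓝 (p w)))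
    (w : RSpace n) : supportFunction (subdifferential g x) w = p w := by
  refine le_antisymm (iSup₂_le fun v hv => ?_) ?_
  · rw [hf.mem_subdifferential_iff hs hgf hx] at hv
    rw [EReal.coe_le_coe_iff]
    refine ge_of_tendsto (hp w) ?_
    filter_upwards [self_mem_nhdsWithin,
      (tendsto_add_smul_nhdsGT_zero x w).eventually (hs.mem_nhds hx)] with t ht hmem
    have h := hv _ hmem
    rw [add_sub_cancel_left, inner_smul_right] at h
    rw [le_div_iff₀ ht]
    linarith
  · obtain ⟨v, hv, hvw⟩ := exists_inner_le_sublinear_eq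
      (fun c hc w => directional_derivative_smul hp hc w)
      (hf.directional_derivative_add_le hs hx hp) w
    have hmem : v ∈ subdifferential g x := by
      rw [hf.mem_subdifferential_iff hs hgf hx]
      intro z hz
      linarith [hv (z - x), hf.add_directional_derivative_le hx hp hz]
    rw [← hvw]
    exact le_iSup₂_of_le (f := fun (v : RSpace n) (_ : v ∈ subdifferential g x) =>
      ((inner ℝ v w : ℝ) : EReal)) v hmem le_rfl

/-- The subderivative of a convex function is its directional derivative. -/
theorem ConvexOn.subderivative_eq (hf : ConvexOn ℝ s f) (hs : IsOpen s)
    (hgf : ∀ y ∈ s, g y = f y) (hx : x ∈ s)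
    (hp : ∀ w, Tendsto (fun t : ℝ => (f (x + t • w) - f x) / t) (𝓝[>] 0) (𝓝 (p w)))
    (w : RSpace n) : subderivative g x w = p w := by
  have hquot : ∀ (t : ℝ) (z : RSpace n), x + t • z ∈ s →
      (g (x + t • z) - g x) / (t : EReal) = (((f (x + t • z) - f x) / t : ℝ) : EReal) := by
    intro t z hz
    rw [hgf _ hz, hgf x hx, EReal.coe_div, EReal.coe_sub]
  refine le_antisymm ?_ ?_
  -- Fixing `w' = w` bounds the liminf above by the directional limit.
  · have hle : map (fun t : ℝ => (t, w)) (𝓝[>] 0) ≤ 𝓝[>] (0 : ℝ) ×ˢ 𝓝 w :=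
      tendsto_id.prodMk tendsto_const_nhds
    refine (liminf_le_liminf_of_le hle).trans_eq ?_
    refine Tendsto.liminf_eq (tendsto_map'_iff.2 ?_)
    refine ((continuous_coe_real_ereal.tendsto _).comp (hp w)).congr' ?_
    filter_upwards [(tendsto_add_smul_nhdsGT_zero x w).eventually (hs.mem_nhds hx)] with t ht
    simp only [Function.comp_apply]
    rw [hquot t w ht]
  -- A linear minorant of `p` touching it at `w` bounds the quotients below by a continuous function
  -- of `w'`, so continuity of `p` is not needed.
  · obtain ⟨v, hv, hvw⟩ := exists_inner_le_sublinear_eq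
      (fun c hc w => directional_derivative_smul hp hc w)
      (hf.directional_derivative_add_le hs hx hp) w
    have hlim : Tendsto (fun q : ℝ × RSpace n => ((inner ℝ v q.2 : ℝ) : EReal))
        (𝓝[>] (0 : ℝ) ×ˢ 𝓝 w) (𝓝 (p w : EReal)) := by
      rw [← hvw]
      exact (continuous_coe_real_ereal.tendsto _).comp
        (tendsto_const_nhds.inner tendsto_snd)
    rw [← hlim.liminf_eq]
    refine liminf_le_liminf ?_
    have hpt : Tendsto (fun q : ℝ × RSpace n => x + q.1 • q.2)
        (𝓝[>] (0 : ℝ) ×ˢ 𝓝 w) (𝓝 x) := by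
      have h1 : Tendsto (fun q : ℝ × RSpace n => q.1) (𝓝[>] (0 : ℝ) ×ˢ 𝓝 w) (𝓝 0) :=
        tendsto_fst.mono_right nhdsWithin_le_nhds
      simpa using (tendsto_const_nhds (x := x)).add (h1.smul tendsto_snd)
    have hpos : ∀ᶠ q in 𝓝[>] (0 : ℝ) ×ˢ 𝓝 w, 0 < q.1 :=
      tendsto_fst.eventually (self_mem_nhdsWithin : Set.Ioi (0 : ℝ) ∈ 𝓝[>] 0)
    filter_upwards [hpt.eventually (hs.mem_nhds hx), hpos] with q hq hq0
    rw [hquot _ _ hq, EReal.coe_le_coe_iff, le_div_iff₀ hq0]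
    have h := hf.add_directional_derivative_le hx hp hq
    rw [add_sub_cancel_left, directional_derivative_smul hp hq0] at h
    nlinarith [hv q.2]

end Representation

/-! ### Comparison with the tangent cone model -/

-- A point within `ρ / 2` of `x` is closer to `x` than to anything outside the `ρ`-ball, so the
-- parts of the sets outside `V` do not affect the distance.
open Metric in
theorem Metric.infDist_eventually_eq_of_inter_eq {E : Type*} [PseudoMetricSpace E] {x : E}
    {S T V : Set E} (hV : V ∈ 𝓝 x) (hS : x ∈ S) (hT : x ∈ T) (h : S ∩ V = T ∩ V) :
    ∀ᶠ y in 𝓝 x, infDist y S = infDist y T := by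
  obtain ⟨ρ, hρ, hρV⟩ := Metric.mem_nhds_iff.1 hV
  have key : ∀ A B : Set E, x ∈ A → x ∈ B → B ∩ V ⊆ A → ∀ y ∈ ball x (ρ / 2),
      infDist y A ≤ infDist y B := by
    intro A B hA hB hBA y hy
    refine (le_infDist ⟨x, hB⟩).2 fun {z} hz => ?_
    by_cases hzV : z ∈ V
    · exact infDist_le_dist_of_mem (hBA ⟨hz, hzV⟩)
    · have h1 : ρ ≤ dist z x := by
        by_contra hlt
        exact hzV (hρV (not_le.1 hlt))
      have h2 := dist_triangle_left z x y
      have h3 : dist y x < ρ / 2 := hy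
      exact (infDist_le_dist_of_mem hA).trans (by linarith)
  filter_upwards [ball_mem_nhds x (half_pos hρ)] with y hy
  exact le_antisymm (key S T hS hT (h ▸ Set.inter_subset_left) y hy)
    (key T S hT hS (h.symm ▸ Set.inter_subset_left) y hy)

/-- A function finite and convex near a boundary point of its level set vanishes there. -/
theorem FiniteConvexOn.eq_zero_of_mem_frontier {n : ℕ} {g : RSpace n → EReal} {x : RSpace n}
    {U : Set (RSpace n)} (hU : U ∈ 𝓝 x) (hg : FiniteConvexOn U g)
    (hx : x ∈ frontier (levelSet g)) : g x = 0 := by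
  obtain ⟨f, r, hr, -, hf, hgf⟩ := hg.exists_ball hU
  have hball : Metric.ball x r ∈ 𝓝 x := Metric.ball_mem_nhds x hr
  have hfx : ContinuousAt f x := hf.continuousAt hball
  have hgx := hgf x (Metric.mem_ball_self hr)
  rcases lt_trichotomy (f x) 0 with h | h | h
  · refine absurd (mem_interior_iff_mem_nhds.2 ?_) hx.2
    filter_upwards [hball, hfx.eventually (gt_mem_nhds h)] with y hy hy0
    show g y ≤ 0
    rw [hgf y hy]
    exact_mod_cast hy0.le
  · rw [hgx, h, EReal.coe_zero]
  · obtain ⟨y, hyS, hy, hy0⟩ := ((mem_closure_iff_frequently.1 hx.1).and_eventually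
      ((eventually_mem_set.2 hball).and (hfx.eventually (lt_mem_nhds h)))).exists
    have hyS : g y ≤ 0 := hyS
    rw [hgf y hy] at hyS
    exact absurd (show f y ≤ 0 by exact_mod_cast hyS) (not_le.2 hy0)

open scoped Pointwise in
theorem mainTheorem3 (n : ℕ) (φ : RSpace n → EReal) (hφ : ∀ x, φ x ≠ ⊥)
    (xbar : RSpace n) (hbd : xbar ∈ frontier (levelSet φ))
    (hconv : ∃ U ∈ 𝓝 xbar, FiniteConvexOn U φ)
    (hreg : ∃ V ∈ 𝓝 xbar,
      levelSet φ ∩ V = ((fun w => xbar + w) '' levelSet (subderivative φ xbar)) ∩ V) :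
    Metric.infEDist 0 (outerSubdifferential φ xbar) = errorBoundModulus φ xbar ∧
    errorBoundModulus φ xbar =
      Metric.infEDist 0
        (outerSubdifferential (supportFunction (subdifferential φ xbar)) 0) := by
  obtain ⟨U, hU, hconv⟩ := hconv
  obtain ⟨V, hV, hSV⟩ := hreg
  have hx0 : φ xbar = 0 := hconv.eq_zero_of_mem_frontier hU hbd
  obtain ⟨f, r, hr, hfc, -, hgf⟩ := hconv.exists_ball hU
  have hxr : xbar ∈ Metric.ball xbar r := Metric.mem_ball_self hr
  have hball : Metric.ball xbar r ∈ 𝓝 xbar := Metric.ball_mem_nhds xbar hr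
  have hev : ∀ᶠ y in 𝓝 xbar, φ y = f y := by filter_upwards [hball] with y hy using hgf y hy
  have hfx : f xbar = 0 := by
    have := hgf xbar hxr
    rw [hx0] at this
    exact_mod_cast this.symm
  choose p hp using hfc.exists_tendsto_directional_quotient Metric.isOpen_ball hxr
  have hom : ∀ c : ℝ, 0 < c → ∀ w, p (c • w) = c * p w :=
    fun c hc w => directional_derivative_smul hp hc w
  have hadd := hfc.directional_derivative_add_le Metric.isOpen_ball hxr hp
  have p0 : p 0 = 0 := by
    have := hom 2 two_pos 0
    rw [smul_zero] at this
    linarith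
  have hσ : supportFunction (subdifferential φ xbar) = fun w => (p w : EReal) :=
    funext (hfc.supportFunction_subdifferential Metric.isOpen_ball hgf hxr hp)
  have hsub : subderivative φ xbar = fun w => (p w : EReal) :=
    funext (hfc.subderivative_eq Metric.isOpen_ball hgf hxr hp)
  set σ : RSpace n → EReal := fun w => (p w : EReal) with hσdef
  rw [hσ]
  rw [hsub] at hSV
  have hpc : FiniteConvexOn Set.univ σ := by
    refine ⟨fun w _ => by simp [hσdef], convex_univ, fun v _ w _ a b ha hb _ => ?_⟩
    have hom' : ∀ c : ℝ, 0 ≤ c → ∀ w, p (c • w) = c * p w := fun c hc w => by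
      rcases hc.eq_or_lt with rfl | hc
      · simp [p0]
      · exact hom c hc w
    simpa [hσdef, hom' a ha, hom' b hb] using hadd (a • v) (b • w)
  have hσ0 : σ 0 = 0 := by simp [hσdef, p0]
  rw [hpc.infEDist_outerSubdifferential_eq univ_mem hσ0]
  refine ⟨hconv.infEDist_outerSubdifferential_eq hU hx0, ?_⟩
  have hxS : xbar ∈ levelSet φ := hx0.le
  have h0C : (0 : RSpace n) ∈ levelSet σ := hσ0.le
  have hdist : ∀ᶠ y in 𝓝 xbar,
      Metric.infDist y (levelSet φ) = Metric.infDist (y - xbar) (levelSet σ) := by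
    have hxC : xbar ∈ (fun w => xbar + w) '' levelSet σ := ⟨0, h0C, add_zero xbar⟩
    filter_upwards [Metric.infDist_eventually_eq_of_inter_eq hV hxS hxC hSV] with y hy
    rw [hy, ← Metric.infDist_image (x := y - xbar) (isometry_add_left xbar),
      add_sub_cancel]
  have hcone : ∀ t : ℝ, 0 < t → ∀ w,
      Metric.infDist (t • w) (levelSet σ) = t * Metric.infDist w (levelSet σ) := by
    intro t ht w
    have hC : t • levelSet σ = levelSet σ := by
      ext z
      rw [Set.mem_smul_set_iff_inv_smul_mem₀ ht.ne']
      simp only [levelSet, hσdef, Set.mem_ofPred_eq, hom _ (inv_pos.2 ht)]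
      norm_cast
      exact ⟨fun h => by
        by_contra hz
        exact absurd h (not_le.2 (mul_pos (inv_pos.2 ht) (not_le.1 hz))),
        fun h => mul_nonpos_of_nonneg_of_nonpos (inv_pos.2 ht).le h⟩
    conv_lhs => rw [← hC]
    rw [infDist_smul₀ ht.ne', Real.norm_of_nonneg ht.le]
  have hiff : ∀ τ : ℝ≥0, IsErrorBoundConstant φ xbar τ ↔ IsErrorBoundConstant σ 0 τ := by
    intro τ
    rw [isErrorBoundConstant_iff ⟨_, hxS⟩ hev,
      isErrorBoundConstant_iff (f := p) ⟨_, h0C⟩ (Eventually.of_forall fun _ => rfl)]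
    refine and_congr_right fun _ => ⟨fun h => Eventually.of_forall fun w => ?_, fun h => ?_⟩
    -- Apply the bound at `xbar + t • w` and divide by `t`: the distance scales exactly since the
    -- level set of `σ` is a cone, and the quotient tends to `p w`. The result holds for every `w`,
    -- not only near the origin.
    · refine ge_of_tendsto ((hp w).max tendsto_const_nhds) ?_
      have hl := tendsto_add_smul_nhdsGT_zero xbar w
      filter_upwards [self_mem_nhdsWithin, hl.eventually h, hl.eventually hdist] with t ht h1 h2
      have ht : 0 < t := ht
      rw [h2, add_sub_cancel_left, hcone t ht] at h1
      rw [hfx, sub_zero, ← zero_div t, max_div_div_right ht.le, le_div_iff₀ ht]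
      linarith
    · have hl : Tendsto (fun y => y - xbar) (𝓝 xbar) (𝓝 0) := by
        have : Tendsto (fun y => y - xbar) (𝓝 xbar) (𝓝 (xbar - xbar)) :=
          Continuous.tendsto (by fun_prop) _
        simpa using this
      filter_upwards [hl.eventually h, hdist, hball] with y h1 h2 hy
      rw [h2]
      refine h1.trans (max_le_max_right _ ?_)
      have := hfc.add_directional_derivative_le hxr hp hy
      linarith
  simp only [errorBoundModulus, hiff]
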